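/- For an integer $n\ge 0$ let $L_n$ be the real Lie algebra with basis $X_0,\dots,X_n$ whose nonzero brackets are $[X_0,X_i]=X_{i+1}$ for $1\le i\le n-1$ (up to skew-symmetry). For real numbers $a=(a_1,\dots,a_{n-1})$ let $L_n(a)$ be the Lie algebra with basis $X_0,\dots,X_n$ and nonzero brackets $[X_0,X_i]=a_iX_{i+1}$ for $1\le i\le n-1$, and let $Q_0$ be the inner product on $L_n(a)$ for which $X_0,\dots,X_n$ is orthonormal. For an inner product $Q$ on a finite-dimensional real nilpotent Lie algebra $\mathfrak n$ and a $Q$-orthonormal basis $(e_i)$ of $\mathfrak n$, the Ricci endomorphism $\mathrm{Ric}$ is defined by $$Q(\mathrm{Ric}\,x,y)=-\tfrac12\sum_i Q([x,e_i],[y,e_i])+\tfrac14\sum_{i,j}Q([e_i,e_j],x)\,Q([e_i,e_j],y).$$ $Q$ is called a nilsoliton metric with nilsoliton constant $\beta\in\mathbb R$ if $\mathrm{Ric}-\beta\,\mathrm{Id}$ is a derivation of $\mathfrak n$, and a nilsoliton metric if this holds for some $\beta$. **Theorem.** For every $n$: 1. $L_n$ admits a nilsoliton metric. 2. It is unique up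 to scaling and automorphisms: if $Q,Q'$ are nilsoliton metrics on $L_n$, then there are $c>0$ and a Lie algebra automorphism $\varphi$ of $L_n$ with $Q'(x,y)=c\,Q(\varphi x,\varphi y)$ for all $x,y$. 3. Explicitly, for every $\nu>0$ and $a_i=\sqrt{\tfrac{\nu}{2}\,i(n-i)}$ (so $a_i=\sqrt{i(n-i)}$ for $\nu=2$), the Lie algebra $L_n(a)$ is isomorphic to $L_n$; the inner product $Q_0$ on $L_n(a)$ is a nilsoliton metric with nilsoliton constant $\beta=-\tfrac{\nu}{2}\left(\tfrac{(n-1)n(n+1)}{12}+1\right)$; and for every nilsoliton metric $Q$ on $L_n$ there are $c>0$ and a Lie algebra isomorphism $\varphi:L_n(a)\to L_n$ with $Q(\varphi x,\varphi y)=c\,Q_0(x,y)$ for all $x,y$. 4. Let $a_1,\dots,a_{n-1}$ be nonzero real numbers. Then $L_n(a)\cong L_n$, and the following are equivalent: (i) $Q_0$ is a nilsoliton metric on $L_n(a)$; (ii) the vector $v=(a_1^2,\dots,a_{n-1}^2)^T$ satisfies $Av=\nu(1,\dots,1)^T$ for some $\nu>0$, where $A$ is the Cartan matrix of type $A_{n-1}$;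 (iii) there is $\nu>0$ with $a_i^2=\tfrac{\nu}{2}\,i(n-i)$ for all $1\le i\le n-1$. (For $n\le 1$ all three hold trivially.) -/

import Mathlib

section MetricLieAlgebra

variable {L : Type*} [LieRing L] [LieAlgebra ℝ L]

/-- An inner product on a real vector space: a symmetric positive definite bilinear form. -/
structure IsInnerProductForm (Q : LinearMap.BilinForm ℝ L) : Prop where
  symm : ∀ x y, Q x y = Q y x
  pos : ∀ x, x ≠ 0 → 0 < Q x x

/-- The basis `e` is orthonormal for `Q`. -/
def IsOrthonormalBasisFor {ι : Type*} [DecidableEq ι] (Q : LinearMap.BilinForm ℝ L)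
    (e : Module.Basis ι ℝ L) : Prop :=
  ∀ i j, Q (e i) (e j) = if i = j then 1 else 0

/-- The nil-Ricci form of the metric Lie algebra `(L, Q)`, computed in the basis `e`
(to be used for `Q`-orthonormal bases `e`, for which it does not depend on `e`). For a nilpotent
Lie algebra it is the Ricci form of the left-invariant metric defined by `Q` on the
corresponding simply connected Lie group. -/
noncomputable def nilRicciForm {ι : Type*} [Fintype ι] (Q : LinearMap.BilinForm ℝ L)
    (e : Module.Basis ι ℝ L) (x y : L) : ℝ :=
  -(1 / 2) * ∑ i, Q ⁅x, e i⁆ ⁅y, e i⁆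
    + (1 / 4) * ∑ i, ∑ j, Q ⁅e i, e j⁆ x * Q ⁅e i, e j⁆ y

/-- `R` is the nil-Ricci endomorphism of `(L, Q)`: `Q (R x) y = ric (x, y)`, where the form `ric`
is computed in an orthonormal basis. -/
def IsNilRicciEndomorphism (Q : LinearMap.BilinForm ℝ L) (R : Module.End ℝ L) : Prop :=
  ∃ (m : ℕ) (e : Module.Basis (Fin m) ℝ L), IsOrthonormalBasisFor Q e ∧
    ∀ x y, Q (R x) y = nilRicciForm Q e x y

/-- `Q` is a nilsoliton metric on `L` with nilsoliton constant `β`: it is an inner product, and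
`Ric - β Id` is a derivation of `L`. -/
def IsNilsolitonMetricWith (Q : LinearMap.BilinForm ℝ L) (β : ℝ) : Prop :=
  IsInnerProductForm Q ∧ ∃ R : Module.End ℝ L, IsNilRicciEndomorphism Q R ∧
    ∃ D : LieDerivation ℝ L L, ∀ x, D x = R x - β • x

/-- `Q` is a nilsoliton metric on `L`. -/
def IsNilsolitonMetric (Q : LinearMap.BilinForm ℝ L) : Prop :=
  ∃ β : ℝ, IsNilsolitonMetricWith Q β

end MetricLieAlgebra

/-- The vector space with basis `X₀, …, Xₙ`, to be given the bracket
`[X₀, Xᵢ] = aᵢ Xᵢ₊₁` for `1 ≤ i ≤ n - 1`. Only the values `a 1, …, a (n - 1)` matter. -/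
def WeightedFiliform (n : ℕ) (_a : ℕ → ℝ) : Type := Fin (n + 1) → ℝ

namespace WeightedFiliform

variable {n : ℕ} {a : ℕ → ℝ}

instance : AddCommGroup (WeightedFiliform n a) :=
  inferInstanceAs (AddCommGroup (Fin (n + 1) → ℝ))

instance : Module ℝ (WeightedFiliform n a) :=
  inferInstanceAs (Module ℝ (Fin (n + 1) → ℝ))

/-- The bracket in coordinates: the coefficient of `Xₖ` in `[x, y]` is
`aₖ₋₁ (x₀ yₖ₋₁ - xₖ₋₁ y₀)` for `k ≥ 2`, and `0` for `k = 0, 1`. -/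
def bracket (x y : WeightedFiliform n a) : WeightedFiliform n a := fun k =>
  if 2 ≤ (k : ℕ) then
    a (k - 1) * (x 0 * y ⟨k - 1, by omega⟩ - x ⟨k - 1, by omega⟩ * y 0)
  else 0

instance : Bracket (WeightedFiliform n a) (WeightedFiliform n a) := ⟨bracket⟩

theorem lie_apply (x y : WeightedFiliform n a) (k : Fin (n + 1)) :
    (⁅x, y⁆ : WeightedFiliform n a) k = if 2 ≤ (k : ℕ) then
      a (k - 1) * (x 0 * y ⟨k - 1, by omega⟩ - x ⟨k - 1, by omega⟩ * y 0) else 0 := rfl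

theorem add_apply (x y : WeightedFiliform n a) (k : Fin (n + 1)) : (x + y) k = x k + y k := rfl

theorem smul_apply (c : ℝ) (x : WeightedFiliform n a) (k : Fin (n + 1)) :
    (c • x) k = c * x k := rfl

theorem zero_apply (k : Fin (n + 1)) : (0 : WeightedFiliform n a) k = 0 := rfl

instance : LieRing (WeightedFiliform n a) where
  add_lie x y z := by
    funext k
    simp only [lie_apply, add_apply]
    split_ifs <;> ring
  lie_add x y z := by
    funext k
    simp only [lie_apply, add_apply]
    split_ifs <;> ring
  lie_self x := by
    funext k
    simp only [lie_apply, zero_apply]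
    split_ifs <;> ring
  leibniz_lie x y z := by
    funext k
    have h0 : ¬ 2 ≤ ((0 : Fin (n + 1)) : ℕ) := by simp
    simp only [lie_apply, add_apply, if_neg h0]
    split_ifs <;> ring

instance : LieAlgebra ℝ (WeightedFiliform n a) where
  lie_smul c x y := by
    funext k
    simp only [lie_apply, smul_apply]
    split_ifs <;> ring

/-- The basis `X₀, …, Xₙ`. -/
noncomputable def basis (n : ℕ) (a : ℕ → ℝ) : Module.Basis (Fin (n + 1)) ℝ (WeightedFiliform n a) :=
  Module.Basis.ofEquivFun (LinearEquiv.refl ℝ (Fin (n + 1) → ℝ))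

/-- The inner product for which the basis `X₀, …, Xₙ` is orthonormal. -/
def stdMetric (n : ℕ) (a : ℕ → ℝ) : LinearMap.BilinForm ℝ (WeightedFiliform n a) :=
  LinearMap.mk₂ ℝ (fun x y => ∑ i, x i * y i)
    (fun x y z => by simp only [add_apply, add_mul, Finset.sum_add_distrib])
    (fun c x y => by simp only [smul_apply, smul_eq_mul, Finset.mul_sum, mul_assoc])
    (fun x y z => by simp only [add_apply, mul_add, Finset.sum_add_distrib])
    (fun c x y => by
      simp only [smul_apply, smul_eq_mul, Finset.mul_sum]
      exact Finset.sum_congr rfl fun i _ => by ring)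

theorem basis_apply (i k : Fin (n + 1)) : basis n a i k = if k = i then 1 else 0 := by
  have h : basis n a i = (Pi.single i 1 : Fin (n + 1) → ℝ) :=
    congrFun (Module.Basis.coe_ofEquivFun (LinearEquiv.refl ℝ (Fin (n + 1) → ℝ))) i
  rw [h, Pi.single_apply]

theorem basis_orthonormal : IsOrthonormalBasisFor (stdMetric n a) (basis n a) := by
  intro i j
  simp [stdMetric, basis_apply, eq_comm]

/-- `[X₀, Xᵢ] = aᵢ Xᵢ₊₁` for `1 ≤ i ≤ n - 1`. -/
theorem lie_basis_zero (i : ℕ) (h1 : 1 ≤ i) (hi : i + 1 < n + 1) :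
    ⁅basis n a 0, basis n a ⟨i, by omega⟩⁆ = a i • basis n a ⟨i + 1, hi⟩ := by
  funext k
  have hi0 : i ≠ 0 := by omega
  simp only [lie_apply, smul_apply, basis_apply, Fin.ext_iff, Fin.val_zero]
  by_cases hk : (k : ℕ) = i + 1
  · simp [hk, h1, hi0.symm]
  · by_cases h2 : 2 ≤ (k : ℕ)
    · have h3 : (k : ℕ) - 1 ≠ i := by omega
      have h4 : (k : ℕ) - 1 ≠ 0 := by omega
      simp [hk, h3, h4]
    · simp [hk, h2]

/-- `[X₀, Xₙ] = 0`. -/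
theorem lie_basis_zero_last : ⁅basis n a 0, basis n a (Fin.last n)⁆ = 0 := by
  funext k
  have hk := k.2
  simp only [lie_apply, zero_apply, basis_apply, Fin.ext_iff, Fin.val_zero, Fin.val_last]
  by_cases h2 : 2 ≤ (k : ℕ)
  · have h3 : (k : ℕ) - 1 ≠ n := by omega
    have h4 : (k : ℕ) - 1 ≠ 0 := by omega
    simp [h3, h4]
  · simp [h2]

/-- `[Xᵢ, Xⱼ] = 0` for `i, j ≥ 1`. -/
theorem lie_basis_of_ne_zero (i j : Fin (n + 1)) (hi : i ≠ 0) (hj : j ≠ 0) :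
    ⁅basis n a i, basis n a j⁆ = 0 := by
  funext k
  simp [lie_apply, zero_apply, basis_apply, hi.symm, hj.symm]

end WeightedFiliform

/-- The filiform Lie algebra `L_n`, of dimension `n + 1`, with `[X₀, Xᵢ] = Xᵢ₊₁` for
`1 ≤ i ≤ n - 1`. -/
abbrev FiliformL (n : ℕ) : Type := WeightedFiliform n (fun _ => 1)

/-! For the standard metric of `L_n(a)` the Ricci endomorphism is diagonal in `X₀, …, Xₙ`. With `u_k
= a_k²` and `u_0 = u_n = 0` its eigenvalues are `r_0 = -½ ∑ u_j` and `r_k = ½ (u_{k-1} - u_k)`.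
Subtracting `β` gives a derivation when the shifted eigenvalues add along every nonzero bracket,
that is, `2 u_k - u_{k-1} - u_{k+1} = ν` with `ν = 2 (r_0 - β)`. This is the Cartan system of type
`A_{n-1}`, a discrete Poisson equation with Dirichlet boundary values; its only solution is `u_k =
ν/2 · k (n - k)` (`discrete_poisson`).

Uniqueness reduces an arbitrary nilsoliton metric to this case. Gram–Schmidt along the flag `tail n
k` gives an adapted orthonormal basis `e`. For `n ≥ 3` every derivation preserves the flag
(`derivation_mem_tail`), and `D = Ric - β` is also symmetric, hence diagonal in `e`. Its eigenvalues
at `e_1, …, e_n` form an arithmetic progression with difference `d_0`. Since `ric(e_1, e_1) < 0 <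
ric(e_n, e_n)`, `d_0 ≠ 0`, so these eigenvalues are distinct and `[e_0, e_i]` is a multiple of
`e_{i+1}`. The metric is then a standard one (`exists_isometry_stdMetric`), its weights are known up
to a common factor, and a homothety of the basis absorbs that factor. -/

section MetricLieAlgebra

variable {L : Type*} [LieRing L] [LieAlgebra ℝ L] {Q : LinearMap.BilinForm ℝ L}

theorem IsInnerProductForm.eq_zero (hQ : IsInnerProductForm Q) {x : L} (h : Q x x = 0) : x = 0 := by
  by_contra hx
  exact (hQ.pos x hx).ne' h

/-! ### Independence of the Ricci form from the orthonormal basis -/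

section Orthonormal

variable {ι κ : Type*} [Fintype ι] [DecidableEq ι] [Fintype κ] [DecidableEq κ]

theorem IsOrthonormalBasisFor.apply_left {e : Module.Basis ι ℝ L} (he : IsOrthonormalBasisFor Q e)
    (i : ι) (x : L) : Q (e i) x = e.repr x i := by
  conv_lhs => rw [← e.sum_repr x]
  simp only [map_sum, map_smul, he i, smul_eq_mul]
  simp

theorem IsOrthonormalBasisFor.parseval {e : Module.Basis ι ℝ L} (he : IsOrthonormalBasisFor Q e)
    (x y : L) : ∑ i, Q (e i) x * Q (e i) y = Q x y := by
  conv_rhs => rw [← e.sum_repr x]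
  simp only [map_sum, map_smul, LinearMap.sum_apply, LinearMap.smul_apply, he.apply_left,
    smul_eq_mul]

/-- The trace of a bilinear form does not depend on the orthonormal basis. -/
theorem IsOrthonormalBasisFor.sum_diag_eq {e : Module.Basis ι ℝ L} {f : Module.Basis κ ℝ L}
    (he : IsOrthonormalBasisFor Q e) (hf : IsOrthonormalBasisFor Q f) (B : LinearMap.BilinForm ℝ L) :
    ∑ i, B (e i) (e i) = ∑ k, B (f k) (f k) := by
  have hsymm (i : ι) (k : κ) : f.repr (e i) k = Q (e i) (f k) := by
    rw [he.apply_left, ← hf.apply_left, ← he.parseval]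
    simp [he _ i, he.apply_left]
  have h1 (i : ι) : B (e i) (e i) =
      ∑ k, ∑ l, Q (e i) (f k) * Q (e i) (f l) * B (f k) (f l) := by
    conv_lhs => rw [← f.sum_repr (e i)]
    simp only [map_sum, map_smul, LinearMap.sum_apply, LinearMap.smul_apply, smul_eq_mul, hsymm,
      Finset.mul_sum, mul_assoc]
    rw [Finset.sum_comm]
    exact Finset.sum_congr rfl fun k _ => Finset.sum_congr rfl fun l _ => by ring
  simp only [h1]
  rw [Finset.sum_comm]
  refine Finset.sum_congr rfl fun k _ => ?_
  rw [Finset.sum_comm]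
  simp only [← Finset.sum_mul, he.parseval, hf k]
  simp

/-- The first sum is the trace of `Q([x,·],[y,·])`. The double sum is a trace in each index
separately, so the basis is exchanged one index at a time. -/
theorem nilRicciForm_eq_of_orthonormal {e : Module.Basis ι ℝ L} {f : Module.Basis κ ℝ L}
    (he : IsOrthonormalBasisFor Q e) (hf : IsOrthonormalBasisFor Q f) (x y : L) :
    nilRicciForm Q e x y = nilRicciForm Q f x y := by
  let ad (z : L) : L →ₗ[ℝ] L := (LieAlgebra.ad ℝ L z : L →ₗ[ℝ] L)
  have h1 := he.sum_diag_eq hf (Q.compl₁₂ (ad x) (ad y))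
  have h2 (z : L) := he.sum_diag_eq hf
    (LinearMap.mk₂ ℝ (fun u v => Q ⁅z, u⁆ x * Q ⁅z, v⁆ y)
      (fun u v w => by simp [add_mul]) (fun c u v => by simp [mul_assoc])
      (fun u v w => by simp [mul_add]) (fun c u v => by simp [mul_left_comm]))
  have h3 (z : L) := he.sum_diag_eq hf
    (LinearMap.mk₂ ℝ (fun u v => Q ⁅u, z⁆ x * Q ⁅v, z⁆ y)
      (fun u v w => by simp [add_mul]) (fun c u v => by simp [mul_assoc])
      (fun u v w => by simp [mul_add]) (fun c u v => by simp [mul_left_comm]))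
  simp only [LinearMap.mk₂_apply, LinearMap.compl₁₂_apply, ad,
    LieAlgebra.ad_apply] at h1 h2 h3
  unfold nilRicciForm
  rw [h1]
  congr 2
  simp only [h2]
  rw [Finset.sum_comm]
  simp only [h3]
  rw [Finset.sum_comm]

end Orthonormal

theorem nilRicciForm_comm {ι : Type*} [Fintype ι] (Q : LinearMap.BilinForm ℝ L) (hQ : ∀ x y, Q x y = Q y x)
    (e : Module.Basis ι ℝ L) (x y : L) : nilRicciForm Q e x y = nilRicciForm Q e y x := by
  unfold nilRicciForm
  congr 2
  · exact Finset.sum_congr rfl fun i _ => hQ _ _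
  · exact Finset.sum_congr rfl fun i _ => Finset.sum_congr rfl fun j _ => mul_comm _ _

/-- The nilsoliton condition tested in a given orthonormal basis. -/
theorem IsNilsolitonMetricWith.exists_derivation {m : ℕ} {β : ℝ}
    (h : IsNilsolitonMetricWith Q β) {e : Module.Basis (Fin m) ℝ L}
    (he : IsOrthonormalBasisFor Q e) :
    ∃ D : LieDerivation ℝ L L, ∀ x y, Q (D x) y = nilRicciForm Q e x y - β * Q x y := by
  obtain ⟨-, R, ⟨k, f, hf, hR⟩, D, hD⟩ := h
  refine ⟨D, fun x y => ?_⟩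
  rw [hD, map_sub, LinearMap.sub_apply, hR, nilRicciForm_eq_of_orthonormal he hf]
  simp

/-- Nilsoliton metrics can be transported along isometric isomorphisms. -/
theorem IsNilsolitonMetricWith.of_equiv {L' : Type*} [LieRing L'] [LieAlgebra ℝ L']
    {Q' : LinearMap.BilinForm ℝ L'} {β : ℝ} (h : IsNilsolitonMetricWith Q β) (ψ : L ≃ₗ⁅ℝ⁆ L')
    (hψ : ∀ x y, Q' (ψ x) (ψ y) = Q x y) : IsNilsolitonMetricWith Q' β := by
  have hs (z : L') : ψ (ψ.symm z) = z := ψ.apply_symm_apply z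
  have hψ' (x y : L') : Q (ψ.symm x) (ψ.symm y) = Q' x y := by rw [← hψ, hs, hs]
  obtain ⟨hQ, R, ⟨k, f, hf, hR⟩, D, hD⟩ := h
  let ψl : L ≃ₗ[ℝ] L' := ψ.toLinearEquiv
  have hψl (x : L) : ψl x = ψ x := rfl
  have hψls (x : L') : ψl.symm x = ψ.symm x := rfl
  refine ⟨⟨fun x y => ?_, fun x hx => ?_⟩, ψl.toLinearMap ∘ₗ R ∘ₗ ψl.symm.toLinearMap,
    ⟨k, f.map ψl, fun i j => ?_, fun x y => ?_⟩,
    ⟨ψl.toLinearMap ∘ₗ D.toLinearMap ∘ₗ ψl.symm.toLinearMap, fun x y => ?_⟩, fun x => ?_⟩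
  · rw [← hψ', ← hψ' y, hQ.symm]
  · rw [← hψ']
    refine hQ.pos _ fun h0 => hx ?_
    rw [← hs x, h0, map_zero]
  · simp only [Module.Basis.map_apply, hψl, hψ, hf i j]
  · have h1 : Q' (ψ (R (ψ.symm x))) y = Q (R (ψ.symm x)) (ψ.symm y) := by rw [← hψ, hs]
    have h2 (x : L') (z : L) : ⁅x, ψ z⁆ = ψ ⁅ψ.symm x, z⁆ := by rw [LieEquiv.map_lie, hs]
    have h3 (x : L') (z : L) : Q' (ψ z) x = Q z (ψ.symm x) := by rw [← hψ, hs]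
    simp only [LinearMap.comp_apply, LinearEquiv.coe_coe, hψl, hψls]
    rw [h1, hR]
    simp only [nilRicciForm, Module.Basis.map_apply, hψl, h2, hψ, h3, ψ.symm_apply_apply]
  · simp only [LinearMap.comp_apply, LinearEquiv.coe_coe, hψl, hψls, LieEquiv.map_lie,
      LieDerivation.coeFn_coe, LieDerivation.apply_lie_eq_sub, map_sub, hs]
  · have := congrArg ψ (hD (ψ.symm x))
    simpa [hs, hψl, hψls] using this

end MetricLieAlgebra

/-! ### Isomorphisms out of `L_n(a)` -/

namespace WeightedFiliform

variable {n : ℕ} {a b : ℕ → ℝ}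

theorem sum_basis (x : WeightedFiliform n a) : ∑ i, x i • basis n a i = x :=
  (basis n a).sum_repr x

/-- A Lie algebra with a basis obeying the bracket relations of `L_n(a)` is isomorphic to it. -/
theorem exists_lieEquiv {L : Type*} [LieRing L] [LieAlgebra ℝ L] (e : Module.Basis (Fin (n + 1)) ℝ L)
    (h0 : ∀ (i : ℕ) (_ : 1 ≤ i) (hi : i + 1 < n + 1), ⁅e 0, e ⟨i, by omega⟩⁆ = a i • e ⟨i + 1, hi⟩)
    (hl : ⁅e 0, e (Fin.last n)⁆ = 0) (h : ∀ i j, i ≠ 0 → j ≠ 0 → ⁅e i, e j⁆ = 0) :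
    ∃ ψ : WeightedFiliform n a ≃ₗ⁅ℝ⁆ L, ∀ i, ψ (basis n a i) = e i := by
  let f : WeightedFiliform n a ≃ₗ[ℝ] L := (basis n a).equiv e (Equiv.refl _)
  have hf (i) : f (basis n a i) = e i := by simp [f]
  have hz (j) : f ⁅basis n a 0, basis n a j⁆ = ⁅e 0, e j⁆ := by
    obtain ⟨j, hj⟩ := j
    rcases Nat.eq_zero_or_pos j with rfl | hj1
    · exact (congrArg f (lie_self _)).trans ((map_zero f).trans (lie_self (e 0)).symm)
    · by_cases hjn : j + 1 < n + 1
      · rw [lie_basis_zero j hj1 hjn, h0 j hj1 hjn, map_smul, hf]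
      · obtain rfl : j = n := by omega
        exact (congrArg f lie_basis_zero_last).trans ((map_zero f).trans hl.symm)
  have hb (i j) : f ⁅basis n a i, basis n a j⁆ = ⁅f (basis n a i), f (basis n a j)⁆ := by
    rw [hf, hf]
    by_cases hi : i = 0
    · rw [hi, hz]
    · by_cases hj : j = 0
      · rw [hj, ← lie_skew, map_neg, hz, lie_skew]
      · rw [lie_basis_of_ne_zero i j hi hj, map_zero, h i j hi hj]
  refine ⟨{ f with map_lie' := ?_ }, hf⟩
  intro x y
  change f ⁅x, y⁆ = ⁅f x, f y⁆
  rw [← sum_basis x, ← sum_basis y]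
  simp only [sum_lie, lie_sum, map_sum, smul_lie, lie_smul, map_smul, hb]

theorem stdMetric_apply (x y : WeightedFiliform n a) : stdMetric n a x y = ∑ i, x i * y i := rfl

/-- An isomorphism sending `X₀, …, Xₙ` to orthogonal vectors of the same length is a similarity. -/
theorem apply_lieEquiv_eq_mul_stdMetric {L : Type*} [LieRing L] [LieAlgebra ℝ L]
    (Q : LinearMap.BilinForm ℝ L) {c : ℝ} (ψ : WeightedFiliform n a ≃ₗ⁅ℝ⁆ L)
    (hψ : ∀ i j, Q (ψ (basis n a i)) (ψ (basis n a j)) = if i = j then c else 0) (x y) :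
    Q (ψ x) (ψ y) = c * stdMetric n a x y := by
  conv_lhs => rw [← sum_basis x, ← sum_basis y]
  simp only [map_sum, map_smul, LinearMap.sum_apply, LinearMap.smul_apply, hψ, stdMetric_apply]
  simp [Finset.mul_sum, mul_comm, mul_left_comm]

/-- A diagonal isomorphism between two of the Lie algebras `L_n(a)`. -/
theorem exists_diagonal_lieEquiv (s : ℕ → ℝ) (hs : ∀ i ≤ n, s i ≠ 0)
    (h : ∀ i, 1 ≤ i → i + 1 ≤ n → s (i + 1) * a i = s 0 * s i * b i) :
    ∃ ψ : WeightedFiliform n a ≃ₗ⁅ℝ⁆ WeightedFiliform n b,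
      ∀ i, ψ (basis n a i) = s i • basis n b i := by
  let e : Module.Basis (Fin (n + 1)) ℝ (WeightedFiliform n b) :=
    (basis n b).isUnitSMul (w := fun i => s i) fun i => (hs i (by omega)).isUnit
  have he (i) : e i = s i • basis n b i := Module.Basis.isUnitSMul_apply _ i
  obtain ⟨ψ, hψ⟩ := exists_lieEquiv (a := a) e
    (fun i h1 hi => by
      simp only [he, smul_lie, lie_smul, lie_basis_zero i h1 hi, smul_smul]
      congr 1
      have := h i h1 (by omega)
      simp only [Fin.val_zero]
      linarith)
    (by simp only [he, smul_lie, lie_smul, lie_basis_zero_last, smul_zero])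
    (fun i j hi hj => by simp only [he, smul_lie, lie_smul, lie_basis_of_ne_zero i j hi hj, smul_zero])
  exact ⟨ψ, fun i => (hψ i).trans (he i)⟩

theorem nonempty_lieEquiv_filiformL (ha : ∀ i, 1 ≤ i → i ≤ n - 1 → a i ≠ 0) :
    Nonempty (WeightedFiliform n a ≃ₗ⁅ℝ⁆ FiliformL n) := by
  obtain ⟨ψ, -⟩ := exists_diagonal_lieEquiv (n := n) (a := a) (b := fun _ => 1)
    -- The recursion `s (i + 1) * a i = s 0 * s i` with `s 0 = s 1 = 1` forces this product.
    (fun k => ∏ j ∈ Finset.Ico 1 k, (a j)⁻¹)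
    (fun i hi => Finset.prod_ne_zero_iff.2 fun j hj => by
      rw [Finset.mem_Ico] at hj
      exact inv_ne_zero (ha j hj.1 (by omega)))
    (fun i h1 hi => by
      have := ha i h1 (by omega)
      rw [Finset.prod_Ico_succ_top h1]
      simp [this])
  exact ⟨ψ⟩

end WeightedFiliform

/-! ### Ricci endomorphism and nilsoliton equation of the standard metric -/

namespace WeightedFiliform

variable {n : ℕ} {a b : ℕ → ℝ}

/-- The squared structure constants of `L_n(a)`, extended by zero. -/
noncomputable def sqWeight (n : ℕ) (a : ℕ → ℝ) (k : ℕ) : ℝ :=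
  if 1 ≤ k ∧ k + 1 ≤ n then a k ^ 2 else 0

theorem sqWeight_of_mem {k : ℕ} (h1 : 1 ≤ k) (hk : k + 1 ≤ n) : sqWeight n a k = a k ^ 2 :=
  if_pos ⟨h1, hk⟩

theorem sqWeight_zero : sqWeight n a 0 = 0 := if_neg (by omega)

theorem sqWeight_self : sqWeight n a n = 0 := if_neg (by omega)

/-- The eigenvalues of the Ricci endomorphism of the standard metric of `L_n(a)`. -/
noncomputable def ricciEigenvalue (n : ℕ) (a : ℕ → ℝ) (k : ℕ) : ℝ :=
  if k = 0 then -(1 / 2) * ∑ j ∈ Finset.range (n + 1), sqWeight n a j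
  else 1 / 2 * (sqWeight n a (k - 1) - sqWeight n a k)

theorem sub_apply (x y : WeightedFiliform n a) (k : Fin (n + 1)) : (x - y) k = x k - y k := rfl

theorem stdMetric_basis_left (i : Fin (n + 1)) (x : WeightedFiliform n a) :
    stdMetric n a (basis n a i) x = x i := by
  rw [stdMetric_apply, Finset.sum_eq_single i]
  · rw [basis_apply, if_pos rfl, one_mul]
  · intro j _ hj
    rw [basis_apply, if_neg hj, zero_mul]
  · simp

theorem stdMetric_basis_right (i : Fin (n + 1)) (x : WeightedFiliform n a) :
    stdMetric n a x (basis n a i) = x i := by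
  rw [← stdMetric_basis_left i x]
  simp only [stdMetric_apply, mul_comm]

theorem sum_stdMetric_lie_basis (x y : WeightedFiliform n a) :
    ∑ i, stdMetric n a ⁅x, basis n a i⁆ ⁅y, basis n a i⁆ =
      ∑ j : Fin (n + 1), sqWeight n a j * (x 0 * y 0 + x j * y j) := by
  simp only [stdMetric_apply]
  rw [Finset.sum_comm]
  have key (k : Fin (n + 1)) :
      ∑ i, (⁅x, basis n a i⁆ : WeightedFiliform n a) k * (⁅y, basis n a i⁆ : WeightedFiliform n a) k
        = if 2 ≤ (k : ℕ) then a (k - 1) ^ 2 *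
          (x 0 * y 0 + x ⟨k - 1, by omega⟩ * y ⟨k - 1, by omega⟩) else 0 := by
    by_cases hk : 2 ≤ (k : ℕ)
    -- Only `i = k - 1` and `i = 0` contribute to coordinate `k`; they differ because `k ≥ 2`, so no
    -- cross terms appear.
    · have hne : (0 : Fin (n + 1)) ≠ ⟨k - 1, by omega⟩ := by
        rw [Ne, Fin.ext_iff]
        simp only [Fin.val_zero]
        omega
      simp only [lie_apply, if_pos hk, basis_apply]
      have hrw (i : Fin (n + 1)) :
          a (k - 1) * (x 0 * (if (⟨k - 1, by omega⟩ : Fin (n + 1)) = i then 1 else 0) -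
            x ⟨k - 1, by omega⟩ * (if 0 = i then 1 else 0)) *
          (a (k - 1) * (y 0 * (if (⟨k - 1, by omega⟩ : Fin (n + 1)) = i then 1 else 0) -
            y ⟨k - 1, by omega⟩ * (if 0 = i then 1 else 0))) =
          a (k - 1) ^ 2 * (x 0 * y 0) * (if (⟨k - 1, by omega⟩ : Fin (n + 1)) = i then 1 else 0) +
          a (k - 1) ^ 2 * (x ⟨k - 1, by omega⟩ * y ⟨k - 1, by omega⟩) *
            (if 0 = i then 1 else 0) := by
        by_cases h1 : (⟨k - 1, by omega⟩ : Fin (n + 1)) = i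
        · have h2 : ¬ 0 = i := fun h => hne (h.trans h1.symm)
          simp only [if_pos h1, if_neg h2]
          ring
        · simp only [if_neg h1]
          split_ifs <;> ring
      simp only [hrw, Finset.sum_add_distrib, ← Finset.mul_sum]
      simp
      ring
    · simp [lie_apply, hk]
  simp only [key]
  -- Reindex by `k = j + 1`: the term `k = 0` vanishes on the left, the term `j = n` on the right.
  rw [Fin.sum_univ_succ, Fin.sum_univ_castSucc]
  simp only [Fin.val_zero, Fin.val_last, sqWeight_self, zero_mul, add_zero, Fin.val_succ,
    Fin.val_castSucc, nonpos_iff_eq_zero, OfNat.ofNat_ne_zero, if_false, zero_add,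
    Nat.add_sub_cancel]
  refine Finset.sum_congr rfl fun j _ => ?_
  have hj := j.2
  by_cases h : 1 ≤ (j : ℕ)
  · rw [if_pos (by omega), sqWeight_of_mem h (by omega)]
    rfl
  · rw [if_neg (by omega), sqWeight, if_neg (by omega), zero_mul]

theorem sum_stdMetric_lie_basis_basis (x y : WeightedFiliform n a) :
    ∑ i, ∑ j, stdMetric n a ⁅basis n a i, basis n a j⁆ x *
        stdMetric n a ⁅basis n a i, basis n a j⁆ y =
      2 * ∑ k : Fin n, sqWeight n a k * (x k.succ * y k.succ) := by
  have h00 : stdMetric n a ⁅basis n a 0, basis n a 0⁆ x = 0 := by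
    rw [lie_self, map_zero, LinearMap.zero_apply]
  have hij (i j : Fin n) : stdMetric n a ⁅basis n a i.succ, basis n a j.succ⁆ x = 0 := by
    rw [lie_basis_of_ne_zero _ _ (Fin.succ_ne_zero i) (Fin.succ_ne_zero j), map_zero,
      LinearMap.zero_apply]
  have hi0 (i : Fin n) : stdMetric n a ⁅basis n a i.succ, basis n a 0⁆ x *
      stdMetric n a ⁅basis n a i.succ, basis n a 0⁆ y =
      stdMetric n a ⁅basis n a 0, basis n a i.succ⁆ x *
        stdMetric n a ⁅basis n a 0, basis n a i.succ⁆ y := by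
    rw [← lie_skew, map_neg, LinearMap.neg_apply, LinearMap.neg_apply, neg_mul_neg]
  simp only [Fin.sum_univ_succ, h00, hij, hi0, zero_mul, zero_add, Finset.sum_const_zero, add_zero]
  rw [two_mul]
  have hmain : ∑ i : Fin n, stdMetric n a ⁅basis n a 0, basis n a i.succ⁆ x *
      stdMetric n a ⁅basis n a 0, basis n a i.succ⁆ y =
      ∑ k : Fin n, sqWeight n a k * (x k.succ * y k.succ) := by
    cases n with
    | zero => simp
    | succ m =>
      rw [Fin.sum_univ_castSucc, Fin.sum_univ_succ]
      have hlast : ⁅basis (m + 1) a 0, basis (m + 1) a (Fin.last m).succ⁆ = 0 := lie_basis_zero_last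
      simp only [hlast, map_zero, LinearMap.zero_apply, mul_zero, Fin.val_zero, sqWeight_zero,
        zero_mul, add_zero, zero_add]
      refine Finset.sum_congr rfl fun j _ => ?_
      have hj : ⁅basis (m + 1) a 0, basis (m + 1) a j.castSucc.succ⁆ =
          a (j + 1) • basis (m + 1) a j.succ.succ :=
        lie_basis_zero (j + 1) (by omega) (by omega)
      rw [hj, sqWeight_of_mem (by simp) (by simp)]
      simp only [map_smul, LinearMap.smul_apply, stdMetric_basis_left, smul_eq_mul, Fin.val_succ]
      ring
  rw [hmain]

/-- Each bracket `[X₀, X_k]` contributes `-½ a_k²` at `X₀` and at `X_k` and `+½ a_k²` at `X_{k+1}`.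
There are no off-diagonal terms, since distinct `X_k` go to multiples of distinct basis vectors. -/
theorem nilRicciForm_stdMetric (x y : WeightedFiliform n a) :
    nilRicciForm (stdMetric n a) (basis n a) x y =
      ∑ i : Fin (n + 1), ricciEigenvalue n a i * (x i * y i) := by
  rw [nilRicciForm, sum_stdMetric_lie_basis, sum_stdMetric_lie_basis_basis]
  simp only [mul_add, Finset.sum_add_distrib, ← Finset.sum_mul]
  rw [Fin.sum_univ_eq_sum_range (sqWeight n a) (n + 1), Fin.sum_univ_succ (n := n),
    Fin.sum_univ_succ (n := n)]
  simp only [ricciEigenvalue, Fin.val_zero, if_pos, sqWeight_zero, Fin.val_succ,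
    Nat.succ_ne_zero, if_false, Nat.add_sub_cancel, zero_mul, zero_add]
  have : ∑ j : Fin n, 1 / 2 * (sqWeight n a j - sqWeight n a (j + 1)) * (x j.succ * y j.succ) =
      1 / 2 * ∑ j : Fin n, sqWeight n a j * (x j.succ * y j.succ) -
      1 / 2 * ∑ j : Fin n, sqWeight n a (j + 1) * (x j.succ * y j.succ) := by
    rw [Finset.mul_sum, Finset.mul_sum, ← Finset.sum_sub_distrib]
    exact Finset.sum_congr rfl fun j _ => by ring
  rw [this]
  ring

theorem isInnerProductForm_stdMetric : IsInnerProductForm (stdMetric n a) where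
  symm x y := by simp only [stdMetric_apply, mul_comm]
  pos x hx := by
    rw [stdMetric_apply]
    refine lt_of_le_of_ne (Finset.sum_nonneg fun i _ => mul_self_nonneg _) fun h => hx ?_
    funext i
    exact mul_self_eq_zero.1
      ((Finset.sum_eq_zero_iff_of_nonneg fun i _ => mul_self_nonneg (x i)).1 h.symm i
        (Finset.mem_univ i))

/-- The endomorphism with eigenvectors `X₀, …, Xₙ` and eigenvalues `d 0, …, d n`. -/
def diagonalEnd (n : ℕ) (a : ℕ → ℝ) (d : ℕ → ℝ) : Module.End ℝ (WeightedFiliform n a) where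
  toFun x := fun i => d i * x i
  map_add' x y := funext fun i => mul_add (d i) (x i) (y i)
  map_smul' c x := funext fun i => mul_left_comm (d i) c (x i)

theorem diagonalEnd_apply (d : ℕ → ℝ) (x : WeightedFiliform n a) (i : Fin (n + 1)) :
    diagonalEnd n a d x i = d i * x i := rfl

/-- A diagonal endomorphism whose eigenvalues are additive along the brackets is a derivation. -/
def diagonalDerivation (n : ℕ) (a : ℕ → ℝ) (d : ℕ → ℝ)
    (hd : ∀ k, 1 ≤ k → k + 1 ≤ n → d (k + 1) = d 0 + d k) :
    LieDerivation ℝ (WeightedFiliform n a) (WeightedFiliform n a) where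
  toLinearMap := diagonalEnd n a d
  leibniz' x y := by
    funext k
    rw [sub_apply, diagonalEnd_apply, lie_apply, lie_apply, lie_apply]
    by_cases hk : 2 ≤ (k : ℕ)
    · have h := hd (k - 1) (by omega) (by omega)
      rw [Nat.sub_add_cancel (by omega)] at h
      simp only [if_pos hk, h, diagonalEnd_apply, Fin.val_zero]
      ring
    · simp [hk]

theorem isNilsolitonMetricWith_stdMetric {β : ℝ}
    (h : ∀ k, 1 ≤ k → k + 1 ≤ n → ricciEigenvalue n a (k + 1) =
      ricciEigenvalue n a 0 + ricciEigenvalue n a k - β) :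
    IsNilsolitonMetricWith (stdMetric n a) β := by
  refine ⟨isInnerProductForm_stdMetric, diagonalEnd n a (ricciEigenvalue n a),
    ⟨n + 1, basis n a, basis_orthonormal, fun x y => ?_⟩,
    diagonalDerivation n a (fun k => ricciEigenvalue n a k - β) (fun k h1 hk => ?_), fun x => ?_⟩
  · rw [nilRicciForm_stdMetric, stdMetric_apply]
    simp only [diagonalEnd_apply, mul_assoc]
  · simp only [h k h1 hk]
    ring
  · funext i
    rw [sub_apply, smul_apply, diagonalEnd_apply]
    exact sub_mul _ _ _

/-- The nilsoliton equation for the standard metric of `L_n(a)`. -/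
theorem ricciEigenvalue_succ_of_isNilsolitonMetricWith {β : ℝ}
    (h : IsNilsolitonMetricWith (stdMetric n a) β) {k : ℕ} (h1 : 1 ≤ k) (hk : k + 1 ≤ n)
    (ha : a k ≠ 0) :
    ricciEigenvalue n a (k + 1) = ricciEigenvalue n a 0 + ricciEigenvalue n a k - β := by
  obtain ⟨D, hD⟩ := h.exists_derivation basis_orthonormal
  have hDi (x : WeightedFiliform n a) (i : Fin (n + 1)) :
      D x i = (ricciEigenvalue n a i - β) * x i := by
    rw [← stdMetric_basis_right i (D x), hD, stdMetric_basis_right, nilRicciForm_stdMetric,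
      Finset.sum_eq_single i]
    · rw [basis_apply, if_pos rfl]
      ring
    · intro j _ hj
      rw [basis_apply, if_neg hj]
      ring
    · simp
  -- The `X_{k+1}` coordinate of the Leibniz rule is the desired equation times `a k`.
  have hl := congrFun (D.apply_lie_eq_sub (basis n a 0) (basis n a ⟨k, by omega⟩))
    (⟨k + 1, by omega⟩ : Fin (n + 1))
  rw [hDi, sub_apply, lie_apply, lie_apply, lie_apply] at hl
  have h2 : 2 ≤ k + 1 := by omega
  have hk0 : k ≠ 0 := by omega
  simp only [hDi, basis_apply, Fin.ext_iff, Fin.val_zero, if_pos h2, Nat.add_sub_cancel, hk0,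
    hk0.symm, if_false, if_true, mul_one, mul_zero, sub_zero, zero_sub, one_mul] at hl
  refine mul_left_cancel₀ ha ?_
  linear_combination hl

end WeightedFiliform

/-- The discrete Poisson equation with constant right-hand side and Dirichlet boundary values. -/
theorem discrete_poisson {n : ℕ} {u : ℕ → ℝ} {ν : ℝ} (h0 : u 0 = 0) (hn : u n = 0)
    (h : ∀ k, 1 ≤ k → k + 1 ≤ n → 2 * u k - u (k - 1) - u (k + 1) = ν) {k : ℕ} (hk : k ≤ n) :
    u k = ν / 2 * ((k : ℝ) * ((n : ℝ) - k)) := by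
  -- The recursion has order two, so two consecutive values are carried. They depend only on `u 1`,
  -- which `u n = 0` then fixes.
  have key (k : ℕ) : k + 1 ≤ n → u k = k * u 1 - ν / 2 * (k * ((k : ℝ) - 1)) ∧
      u (k + 1) = (k + 1) * u 1 - ν / 2 * ((k + 1) * (k : ℝ)) := by
    induction k with
    | zero => simp [h0]
    | succ k ih =>
      intro hk
      obtain ⟨h1, h2⟩ := ih (by omega)
      have h3 := h (k + 1) (by omega) hk
      rw [Nat.add_sub_cancel] at h3
      push_cast
      refine ⟨by rw [h2]; ring, ?_⟩
      linear_combination -h3 + 2 * h2 - h1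
  rcases Nat.eq_zero_or_pos n with rfl | hpos
  · obtain rfl : k = 0 := by omega
    simp [h0]
  · obtain ⟨m, rfl⟩ : ∃ m, n = m + 1 := ⟨n - 1, by omega⟩
    have h1 : u 1 = ν / 2 * m := by
      have h2 := (key m le_rfl).2
      rw [hn] at h2
      have hm : (m : ℝ) + 1 ≠ 0 := by positivity
      refine mul_left_cancel₀ hm ?_
      linear_combination -h2
    rcases Nat.lt_or_ge m k with hmk | hmk
    · obtain rfl : k = m + 1 := by omega
      rw [hn]
      ring
    · rw [(key k (by omega)).1, h1]
      push_cast
      ring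

/-- `N` is kept independent of `m` so that induction on `m` applies; at `N = m = n` the value is `(n
- 1) n (n + 1) / 6`, the source of the cubic term in `β`. -/
theorem sum_range_mul_sub (N : ℝ) (m : ℕ) : ∑ j ∈ Finset.range (m + 1), (j : ℝ) * (N - j) =
    N * (m * (m + 1)) / 2 - m * (m + 1) * (2 * m + 1) / 6 := by
  induction m with
  | zero => simp
  | succ m ih =>
    rw [Finset.sum_range_succ, ih]
    push_cast
    ring

/-! ### The nilsoliton equation as a linear system of type `A_{n-1}` -/

namespace WeightedFiliform

variable {n : ℕ} {a b : ℕ → ℝ}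

/-- The right side of the second-difference equation does not depend on `k`: the global sum in
`ricciEigenvalue n a 0` and the constant `β` enter only through `ν`. -/
theorem ricciEigenvalue_succ_iff {k : ℕ} {β : ℝ} (h1 : 1 ≤ k) :
    ricciEigenvalue n a (k + 1) = ricciEigenvalue n a 0 + ricciEigenvalue n a k - β ↔
      2 * sqWeight n a k - sqWeight n a (k - 1) - sqWeight n a (k + 1) =
        2 * (ricciEigenvalue n a 0 - β) := by
  have e1 : ricciEigenvalue n a (k + 1) = 1 / 2 * (sqWeight n a k - sqWeight n a (k + 1)) := by
    rw [ricciEigenvalue, if_neg (by omega), Nat.add_sub_cancel]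
  have e2 : ricciEigenvalue n a k = 1 / 2 * (sqWeight n a (k - 1) - sqWeight n a k) := by
    rw [ricciEigenvalue, if_neg (by omega)]
  rw [e1, e2]
  constructor <;> intro h <;> linarith

theorem sqWeight_eq_of_sq_eq {ν : ℝ}
    (h : ∀ i : ℕ, 1 ≤ i → i ≤ n - 1 → a i ^ 2 = ν / 2 * ((i : ℝ) * ((n : ℝ) - i)))
    {k : ℕ} (hk : k ≤ n) : sqWeight n a k = ν / 2 * ((k : ℝ) * ((n : ℝ) - k)) := by
  rcases Nat.eq_zero_or_pos k with rfl | h1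
  · simp [sqWeight_zero]
  · rcases hk.eq_or_lt with rfl | hk
    · simp [sqWeight_self]
    · rw [sqWeight_of_mem h1 hk, h k h1 (by omega)]

theorem isNilsolitonMetricWith_stdMetric_of_sq_eq {ν : ℝ}
    (h : ∀ i : ℕ, 1 ≤ i → i ≤ n - 1 → a i ^ 2 = ν / 2 * ((i : ℝ) * ((n : ℝ) - i))) :
    IsNilsolitonMetricWith (stdMetric n a)
      (-(ν / 2) * (((n : ℝ) - 1) * (n : ℝ) * ((n : ℝ) + 1) / 12 + 1)) := by
  have h0 : ricciEigenvalue n a 0 = -(ν / 2) * (((n : ℝ) - 1) * (n : ℝ) * ((n : ℝ) + 1) / 12) := by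
    rw [ricciEigenvalue, if_pos rfl, Finset.sum_congr rfl fun j hj =>
      sqWeight_eq_of_sq_eq h (Nat.lt_succ_iff.1 (Finset.mem_range.1 hj)), ← Finset.mul_sum,
      sum_range_mul_sub]
    ring
  refine isNilsolitonMetricWith_stdMetric fun k h1 hk => ?_
  rw [ricciEigenvalue_succ_iff h1, h0, sqWeight_eq_of_sq_eq h (by omega : k ≤ n),
    sqWeight_eq_of_sq_eq h hk, sqWeight_eq_of_sq_eq h (by omega : k - 1 ≤ n)]
  push_cast [h1]
  ring

theorem exists_sq_eq_of_isNilsolitonMetric (ha : ∀ i : ℕ, 1 ≤ i → i ≤ n - 1 → a i ≠ 0)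
    (h : IsNilsolitonMetric (stdMetric n a)) :
    ∃ ν : ℝ, 0 < ν ∧ ∀ i : ℕ, 1 ≤ i → i ≤ n - 1 →
      a i ^ 2 = ν / 2 * ((i : ℝ) * ((n : ℝ) - i)) := by
  obtain ⟨β, h⟩ := h
  rcases Nat.lt_or_ge n 2 with hn | hn
  · exact ⟨1, one_pos, fun i h1 hi => by omega⟩
  have hu {k : ℕ} (hk : k ≤ n) := discrete_poisson (u := sqWeight n a)
    (ν := 2 * (ricciEigenvalue n a 0 - β)) sqWeight_zero sqWeight_self
    (fun k h1 hk => (ricciEigenvalue_succ_iff h1).1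
      (ricciEigenvalue_succ_of_isNilsolitonMetricWith h h1 hk (ha k h1 (by omega)))) hk
  have hi {i : ℕ} (h1 : 1 ≤ i) (hi : i ≤ n - 1) :=
    (sqWeight_of_mem (a := a) h1 (by omega)).symm.trans (hu (by omega : i ≤ n))
  refine ⟨_, ?_, fun i h1 h2 => hi h1 h2⟩
  -- Positivity of `ν` is read off from `a 1 ^ 2 = ν / 2 * (n - 1)`.
  have h3 := hi (i := 1) le_rfl (by omega)
  have h4 : 0 < a 1 ^ 2 := by
    have := ha 1 le_rfl (by omega)
    positivity
  rw [h3] at h4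
  have h5 : (2 : ℝ) ≤ n := by exact_mod_cast hn
  have h6 := pos_of_mul_pos_left h4 (by push_cast; linarith)
  linarith

/-- Row `i` belongs to node `i + 1`. The neighbours missing in the first and last rows are the zero
boundary values of `sqWeight`. -/
theorem cartanMatrix_mulVec_apply (i : Fin (n - 1)) :
    Matrix.mulVec ((CartanMatrix.A (n - 1)).map (Int.cast : ℤ → ℝ))
      (fun i : Fin (n - 1) => a ((i : ℕ) + 1) ^ 2) i =
    2 * sqWeight n a (i + 1) - sqWeight n a i - sqWeight n a (i + 1 + 1) := by
  have hi := i.2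
  have hterm (j : Fin (n - 1)) :
      (CartanMatrix.A (n - 1)).map (Int.cast : ℤ → ℝ) i j * a ((j : ℕ) + 1) ^ 2 =
        (if (i : ℕ) = j then 2 * sqWeight n a (j + 1) else 0) -
        (if i = (j : ℕ) + 1 then sqWeight n a (j + 1) else 0) -
        (if (i : ℕ) + 1 = j then sqWeight n a (j + 1) else 0) := by
    rw [sqWeight_of_mem (by omega) (by omega), Matrix.map_apply, CartanMatrix.A, Matrix.of_apply]
    by_cases h1 : (i : ℕ) = j
    · have h2 : ¬ (i : ℕ) = j + 1 := by omega
      have h3 : ¬ (i : ℕ) + 1 = j := by omega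
      simp [Fin.ext_iff, h1]
    · by_cases h2 : (i : ℕ) = j + 1
      · have h3 : ¬ (i : ℕ) + 1 = j := by omega
        rw [if_neg (by rw [Fin.ext_iff]; omega), if_pos (Or.inr h2.symm), if_neg h1, if_pos h2,
          if_neg h3]
        simp
      · by_cases h3 : (i : ℕ) + 1 = j
        · rw [if_neg (by rw [Fin.ext_iff]; omega), if_pos (Or.inl h3), if_neg h1, if_neg h2,
            if_pos h3]
          simp
        · rw [if_neg (by rw [Fin.ext_iff]; omega), if_neg (by omega), if_neg h1, if_neg h2,
            if_neg h3]
          simp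
  rw [Matrix.mulVec, dotProduct, Finset.sum_congr rfl fun j _ => hterm j, Finset.sum_sub_distrib,
    Finset.sum_sub_distrib]
  congr 1
  · congr 1
    · rw [Finset.sum_eq_single i]
      · rw [if_pos rfl]
      · intro j _ hj
        exact if_neg fun h => hj (Fin.ext h.symm)
      · simp
    · by_cases h1 : (i : ℕ) = 0
      · rw [h1, sqWeight_zero]
        exact Finset.sum_eq_zero fun j _ => if_neg (by omega)
      · rw [Finset.sum_eq_single ⟨i - 1, by omega⟩]
        · simp only [Nat.sub_add_cancel (Nat.one_le_iff_ne_zero.2 h1), if_true]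
        · intro j _ hj
          exact if_neg fun h => hj (Fin.ext (by simp only; omega))
        · simp
  · by_cases h1 : (i : ℕ) + 1 < n - 1
    · rw [Finset.sum_eq_single ⟨i + 1, h1⟩]
      · simp only [if_true]
      · intro j _ hj
        exact if_neg fun h => hj (Fin.ext h.symm)
      · simp
    · rw [sqWeight, if_neg (by omega)]
      exact Finset.sum_eq_zero fun j _ => if_neg (by omega)

theorem cartanMatrix_mulVec_eq_iff (ν : ℝ) :
    Matrix.mulVec ((CartanMatrix.A (n - 1)).map (Int.cast : ℤ → ℝ))
      (fun i : Fin (n - 1) => a ((i : ℕ) + 1) ^ 2) = (fun _ => ν) ↔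
    ∀ i : ℕ, 1 ≤ i → i ≤ n - 1 → a i ^ 2 = ν / 2 * ((i : ℝ) * ((n : ℝ) - i)) := by
  constructor
  · intro h i h1 hi
    rw [← sqWeight_of_mem (n := n) (a := a) h1 (by omega)]
    refine discrete_poisson sqWeight_zero sqWeight_self (fun k h1 hk => ?_) (by omega)
    rw [← congrFun h ⟨k - 1, by omega⟩, cartanMatrix_mulVec_apply]
    simp only [Nat.sub_add_cancel h1]
  · intro h
    funext i
    have hi := i.2
    rw [cartanMatrix_mulVec_apply, sqWeight_eq_of_sq_eq h (by omega),
      sqWeight_eq_of_sq_eq h (by omega), sqWeight_eq_of_sq_eq h (by omega)]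
    push_cast
    ring

end WeightedFiliform

/-! ### The invariant flag of `L_n` and bases adapted to it -/

namespace WeightedFiliform

variable {n : ℕ}

/-- The span of `X_k, …, X_n` in `L_n`. -/
def tail (n k : ℕ) : Submodule ℝ (FiliformL n) where
  carrier := {x | ∀ j : Fin (n + 1), (j : ℕ) < k → x j = 0}
  add_mem' {x y} hx hy j hj := by rw [add_apply, hx j hj, hy j hj, add_zero]
  zero_mem' _ _ := rfl
  smul_mem' c x hx j hj := by rw [smul_apply, hx j hj, mul_zero]

theorem mem_tail {k : ℕ} {x : FiliformL n} :
    x ∈ tail n k ↔ ∀ j : Fin (n + 1), (j : ℕ) < k → x j = 0 := Iff.rfl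

theorem tail_anti {k l : ℕ} (h : k ≤ l) : tail n l ≤ tail n k :=
  fun _ hx j hj => hx j (hj.trans_le h)

theorem tail_eq_bot {k : ℕ} (h : n < k) : tail n k = ⊥ := by
  rw [eq_bot_iff]
  intro x hx
  exact (Submodule.mem_bot ℝ).2 (funext fun j => hx j (by omega))

theorem lie_mem_tail_two (x y : FiliformL n) : ⁅x, y⁆ ∈ tail n 2 := fun j hj => by
  rw [lie_apply, if_neg (by omega)]

theorem lie_mem_tail_succ {k : ℕ} (hk : 1 ≤ k) (x : FiliformL n) {y : FiliformL n}
    (hy : y ∈ tail n k) : ⁅x, y⁆ ∈ tail n (k + 1) := fun j hj => by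
  rw [lie_apply]
  split_ifs
  · rw [hy ⟨j - 1, by omega⟩ (by simp only; omega), hy 0 (by rw [Fin.val_zero]; omega)]
    ring
  · rfl

theorem lie_eq_zero_of_mem_tail_one {x y : FiliformL n} (hx : x ∈ tail n 1) (hy : y ∈ tail n 1) :
    ⁅x, y⁆ = 0 := by
  funext j
  rw [lie_apply, hx 0 (by simp), hy 0 (by simp), zero_apply]
  simp

theorem exists_lie_eq_of_mem_tail_succ {k : ℕ} (hk : 1 ≤ k) {y : FiliformL n}
    (hy : y ∈ tail n (k + 1)) : ∃ z ∈ tail n k, y = ⁅basis n (fun _ => 1) 0, z⁆ := by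
  -- `ad X₀` raises indices by one, so `y` is shifted down. The last coordinate is free because
  -- `[X₀, Xₙ] = 0`.
  let z : FiliformL n := fun j => if h : (j : ℕ) + 1 < n + 1 then y ⟨j + 1, h⟩ else 0
  have hz (j : Fin (n + 1)) : z j = if h : (j : ℕ) + 1 < n + 1 then y ⟨j + 1, h⟩ else 0 := rfl
  refine ⟨z, fun j hj => ?_, ?_⟩
  · rw [hz]
    split_ifs
    · exact hy _ (by simp only; omega)
    · rfl
  · funext j
    rw [lie_apply]
    by_cases hj : 2 ≤ (j : ℕ)
    · have h0 : (⟨j - 1, by omega⟩ : Fin (n + 1)) ≠ 0 := by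
        rw [Ne, Fin.ext_iff, Fin.val_zero]
        simp only
        omega
      have h1 : (j : ℕ) - 1 + 1 = j := by omega
      rw [if_pos hj, basis_apply, basis_apply, if_pos rfl, if_neg h0, hz,
        dif_pos (by simp only; omega)]
      simp [h1]
    · rw [if_neg hj, hy j (by omega)]

/-- For `n ≥ 3` the subspaces spanned by `X_k, …, X_n` are invariant under all derivations. -/
theorem derivation_mem_tail (hn : 3 ≤ n) (D : LieDerivation ℝ (FiliformL n) (FiliformL n)) (k : ℕ)
    {x : FiliformL n} (hx : x ∈ tail n k) : D x ∈ tail n k := by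
  have htwo {y : FiliformL n} (hy : y ∈ tail n 2) : D y ∈ tail n 2 := by
    obtain ⟨z, -, rfl⟩ := exists_lie_eq_of_mem_tail_succ le_rfl hy
    rw [D.apply_lie_eq_sub]
    exact sub_mem (lie_mem_tail_two _ _) (lie_mem_tail_two _ _)
  -- `tail n 1` is the centralizer of `X₂`, as `[X₀, X₂] = X₃ ≠ 0`; this is where `n ≥ 3` enters. In
  -- `0 = D[x, X₂]` the term `[x, D X₂]` vanishes, hence so does `[D x, X₂]`.
  have hone {x : FiliformL n} (hx : x ∈ tail n 1) : D x ∈ tail n 1 := by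
    let X : FiliformL n := basis n _ ⟨2, by omega⟩
    have hX : X ∈ tail n 2 := fun j hj => by
      change basis n (fun _ => 1) _ j = 0
      rw [basis_apply, if_neg]
      intro h
      rw [h] at hj
      simp at hj
    have h1 : ⁅x, X⁆ = 0 := lie_eq_zero_of_mem_tail_one hx (tail_anti one_le_two hX)
    have h2 := D.apply_lie_eq_sub x X
    rw [h1, map_zero, lie_eq_zero_of_mem_tail_one hx (tail_anti one_le_two (htwo hX)), zero_sub,
      lie_skew] at h2
    have h3 := congrFun h2 ⟨3, by omega⟩
    rw [lie_apply, if_pos (by simp), hX 0 (by simp), zero_apply] at h3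
    intro j hj
    obtain rfl : j = 0 := Fin.ext (by rw [Fin.val_zero]; omega)
    simpa [X, basis_apply] using h3.symm
  cases k with
  | zero => exact fun j hj => absurd hj (by omega)
  | succ k =>
    induction k generalizing x with
    | zero => exact hone hx
    | succ k ih =>
      -- Further terms of the flag are images of the previous ones under `ad X₀`, so invariance
      -- propagates.
      obtain ⟨z, hz, rfl⟩ := exists_lie_eq_of_mem_tail_succ (by omega) hx
      rw [D.apply_lie_eq_sub, sub_eq_add_neg, lie_skew]
      exact add_mem (lie_mem_tail_succ (by omega) _ (ih hz)) (lie_mem_tail_succ (by omega) _ hz)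

instance (n : ℕ) (a : ℕ → ℝ) : FiniteDimensional ℝ (WeightedFiliform n a) :=
  (basis n a).finiteDimensional_of_finite

/-- A Gram–Schmidt step: normalize the component of `X_i` orthogonal to `tail n (i + 1)`. Removing
the other component leaves coordinate `i` equal to `1`. -/
theorem exists_unit_mem_tail {Q : LinearMap.BilinForm ℝ (FiliformL n)} (hQ : IsInnerProductForm Q)
    (i : Fin (n + 1)) : ∃ f ∈ tail n i, 0 < f i ∧ Q f f = 1 ∧ ∀ y ∈ tail n (i + 1), Q f y = 0 := by
  have hc : IsCompl (tail n (i + 1)) (Q.orthogonal (tail n (i + 1))) := by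
    rw [LinearMap.BilinForm.isCompl_orthogonal_iff_disjoint fun x y h => by rw [hQ.symm, h],
      Submodule.disjoint_def]
    exact fun x hx hx' => hQ.eq_zero (hx' x hx)
  obtain ⟨y, hy, f, hf, hyf⟩ := Submodule.mem_sup.1
    (hc.sup_eq_top ▸ Submodule.mem_top : basis n (fun _ => 1) i ∈ _)
  have hf1 (j : Fin (n + 1)) (hj : (j : ℕ) < i + 1) : f j = if j = i then 1 else 0 := by
    have := congrFun hyf j
    rwa [add_apply, hy j hj, zero_add, basis_apply] at this
  have hfi : f i = 1 := by rw [hf1 i (by omega), if_pos rfl]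
  have hpos : 0 < Q f f := hQ.pos f fun h => by
    rw [h, zero_apply] at hfi
    exact zero_ne_one hfi
  have hs := Real.sqrt_pos.2 hpos
  refine ⟨(√(Q f f))⁻¹ • f, Submodule.smul_mem _ _ fun j hj => ?_, ?_, ?_, fun z hz => ?_⟩
  · rw [hf1 j (by omega), if_neg (by rintro rfl; exact lt_irrefl _ hj)]
  · rw [smul_apply, hfi]
    positivity
  · simp only [map_smul, LinearMap.smul_apply, smul_eq_mul]
    have := Real.mul_self_sqrt hpos.le
    field_simp
    rw [sq, this]
  · rw [map_smul, LinearMap.smul_apply, (hQ.symm f z).trans (hf z hz), smul_zero]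

/-- An orthonormal basis adapted to the flag of the subspaces `tail n k`. -/
theorem exists_adapted_basis {Q : LinearMap.BilinForm ℝ (FiliformL n)}
    (hQ : IsInnerProductForm Q) : ∃ e : Module.Basis (Fin (n + 1)) ℝ (FiliformL n),
      IsOrthonormalBasisFor Q e ∧ (∀ i : Fin (n + 1), e i ∈ tail n i) ∧ (∀ i, 0 < e i i) ∧
      ∀ i : Fin (n + 1), ∀ y ∈ tail n (i + 1), Q (e i) y = 0 := by
  choose f hf hpos hnorm horth using exists_unit_mem_tail hQ
  have hon (i j : Fin (n + 1)) : Q (f i) (f j) = if i = j then 1 else 0 := by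
    rcases lt_trichotomy i j with h | h | h
    · rw [if_neg h.ne]
      exact horth i _ (tail_anti h (hf j))
    · rw [if_pos h, h, hnorm]
    · rw [if_neg h.ne', hQ.symm]
      exact horth j _ (tail_anti h (hf i))
  have hli : LinearIndependent ℝ f := by
    rw [Fintype.linearIndependent_iff]
    intro g hg i
    have := congrArg (Q (f i)) hg
    simpa [hon] using this
  have hcard : Fintype.card (Fin (n + 1)) = Module.finrank ℝ (FiliformL n) :=
    (Module.finrank_eq_card_basis (basis n fun _ => 1)).symm
  have he := coe_basisOfLinearIndependentOfCardEqFinrank hli hcard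
  refine ⟨basisOfLinearIndependentOfCardEqFinrank hli hcard, fun i j => ?_, ?_⟩
  · rw [he, hon]
  · rw [he]
    exact ⟨hf, hpos, horth⟩

/-! ### Brackets and Ricci curvature in an adapted basis -/

section Adapted

variable {Q : LinearMap.BilinForm ℝ (FiliformL n)} {e : Module.Basis (Fin (n + 1)) ℝ (FiliformL n)}

theorem lie_sub_smul_mem_tail (hmem : ∀ i : Fin (n + 1), e i ∈ tail n i) (hpos : ∀ i, 0 < e i i)
    {i : ℕ} (h1 : 1 ≤ i) (hi : i + 1 < n + 1) : ∃ t : ℝ, 0 < t ∧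
      ⁅e 0, e ⟨i, by omega⟩⁆ - t • e ⟨i + 1, hi⟩ ∈ tail n (i + 2) := by
  have p0 := hpos 0
  have p1 := hpos ⟨i, by omega⟩
  have p2 := hpos ⟨i + 1, hi⟩
  -- The ratio of the leading coordinates, both at index `i + 1`, of `[e_0, e_i]` and `e_{i+1}`.
  refine ⟨e 0 0 * e ⟨i, by omega⟩ ⟨i, by omega⟩ / e ⟨i + 1, hi⟩ ⟨i + 1, hi⟩,
    div_pos (mul_pos p0 p1) p2, fun j hj => ?_⟩
  rw [sub_apply, smul_apply]
  rcases Nat.lt_succ_iff_lt_or_eq.1 hj with h | h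
  · rw [lie_mem_tail_succ h1 _ (hmem ⟨i, by omega⟩) j h, hmem ⟨i + 1, hi⟩ j h, mul_zero, sub_zero]
  · obtain rfl : j = ⟨i + 1, hi⟩ := Fin.ext h
    rw [div_mul_cancel₀ _ p2.ne', lie_apply, if_pos (by simp only; omega),
      hmem ⟨i, by omega⟩ 0 (by simp only [Fin.val_zero]; omega)]
    simp

theorem apply_lie_succ_pos (he : IsOrthonormalBasisFor Q e)
    (hmem : ∀ i : Fin (n + 1), e i ∈ tail n i) (hpos : ∀ i, 0 < e i i)
    (horth : ∀ i : Fin (n + 1), ∀ y ∈ tail n (i + 1), Q (e i) y = 0)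
    {i : ℕ} (h1 : 1 ≤ i) (hi : i + 1 < n + 1) :
    0 < Q (e ⟨i + 1, hi⟩) ⁅e 0, e ⟨i, by omega⟩⁆ := by
  obtain ⟨t, ht, h⟩ := lie_sub_smul_mem_tail hmem hpos h1 hi
  have h2 := horth ⟨i + 1, hi⟩ _ h
  rw [map_sub, map_smul, he, if_pos rfl, sub_eq_zero] at h2
  rw [h2]
  simpa using ht

/-- `e_1` is orthogonal to all brackets, so only the negative term survives, and `[e_1, e_0] ≠ 0`.
-/
theorem nilRicciForm_one_neg (hQ : IsInnerProductForm Q)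
    (hmem : ∀ i : Fin (n + 1), e i ∈ tail n i) (hpos : ∀ i, 0 < e i i)
    (horth : ∀ i : Fin (n + 1), ∀ y ∈ tail n (i + 1), Q (e i) y = 0)
    (he : IsOrthonormalBasisFor Q e) (hn : 2 ≤ n) :
    nilRicciForm Q e (e ⟨1, by omega⟩) (e ⟨1, by omega⟩) < 0 := by
  have hnn (x : FiliformL n) : 0 ≤ Q x x := by
    rcases eq_or_ne x 0 with rfl | hx
    · simp
    · exact (hQ.pos x hx).le
  have h1 (i j) : Q ⁅e i, e j⁆ (e ⟨1, by omega⟩) = 0 := by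
    rw [hQ.symm]
    exact horth _ _ (lie_mem_tail_two _ _)
  have h2 : 0 < ∑ i, Q ⁅e ⟨1, by omega⟩, e i⁆ ⁅e ⟨1, by omega⟩, e i⁆ := by
    refine Finset.sum_pos' (fun i _ => hnn _) ⟨0, Finset.mem_univ _, hQ.pos _ fun h => ?_⟩
    have h3 := apply_lie_succ_pos he hmem hpos horth le_rfl (by omega : 1 + 1 < n + 1)
    rw [← lie_skew, h] at h3
    simp at h3
  simp only [nilRicciForm, h1, mul_zero, Finset.sum_const_zero, add_zero]
  linarith

/-- `e_n` is central, so only the positive term survives, and `[e_0, e_{n-1}]` has a nonzero `e_n`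
component. -/
theorem nilRicciForm_last_pos (hQ : IsInnerProductForm Q)
    (hmem : ∀ i : Fin (n + 1), e i ∈ tail n i) (hpos : ∀ i, 0 < e i i)
    (horth : ∀ i : Fin (n + 1), ∀ y ∈ tail n (i + 1), Q (e i) y = 0)
    (he : IsOrthonormalBasisFor Q e) (hn : 2 ≤ n) :
    0 < nilRicciForm Q e (e (Fin.last n)) (e (Fin.last n)) := by
  have h1 (i) : ⁅e (Fin.last n), e i⁆ = 0 := by
    rw [← lie_skew, neg_eq_zero]
    have := lie_mem_tail_succ (by simp only [Fin.val_last]; omega) (e i) (hmem (Fin.last n))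
    rwa [tail_eq_bot (by simp), Submodule.mem_bot] at this
  have h2 : 0 < ∑ i, ∑ j, Q ⁅e i, e j⁆ (e (Fin.last n)) * Q ⁅e i, e j⁆ (e (Fin.last n)) := by
    refine Finset.sum_pos' (fun i _ => Finset.sum_nonneg fun j _ => mul_self_nonneg _)
      ⟨0, Finset.mem_univ _, Finset.sum_pos' (fun j _ => mul_self_nonneg _)
        ⟨⟨n - 1, by omega⟩, Finset.mem_univ _, ?_⟩⟩
    have h3 := apply_lie_succ_pos he hmem hpos horth (by omega : 1 ≤ n - 1) (by omega)
    have h4 : (⟨n - 1 + 1, by omega⟩ : Fin (n + 1)) = Fin.last n :=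
      Fin.ext (by simp only [Fin.val_last]; omega)
    rw [h4, hQ.symm] at h3
    exact mul_pos h3 h3
  simp only [nilRicciForm, h1, map_zero, Finset.sum_const_zero, mul_zero, zero_add]
  linarith

theorem lie_eq_smul_of_isNilsolitonMetric_of_three_le (hQ : IsNilsolitonMetric Q)
    (he : IsOrthonormalBasisFor Q e) (hmem : ∀ i : Fin (n + 1), e i ∈ tail n i)
    (hpos : ∀ i, 0 < e i i)
    (horth : ∀ i : Fin (n + 1), ∀ y ∈ tail n (i + 1), Q (e i) y = 0) (hn : 3 ≤ n)
    {i : ℕ} (h1 : 1 ≤ i) (hi : i + 1 < n + 1) :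
    ∃ t : ℝ, ⁅e 0, e ⟨i, by omega⟩⁆ = t • e ⟨i + 1, hi⟩ := by
  obtain ⟨β, hβ⟩ := hQ
  have hin := hβ.1
  obtain ⟨D, hD⟩ := hβ.exists_derivation he
  have hsymm (x y) : Q (D x) y = Q x (D y) := by
    rw [hin.symm x, hD, hD, nilRicciForm_comm Q hin.symm, hin.symm x y]
  have hext {x y : FiliformL n} (h : ∀ j, Q (e j) x = Q (e j) y) : x = y :=
    e.ext_elem fun j => by rw [← he.apply_left, ← he.apply_left, h]
  let d (i : Fin (n + 1)) : ℝ := Q (e i) (D (e i))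
  -- `D` is triangular because it preserves the flag, and it is symmetric; hence it is diagonal.
  have hd (i) : D (e i) = d i • e i := hext fun j => by
    rw [map_smul, he]
    rcases lt_trichotomy j i with h | rfl | h
    · rw [if_neg h.ne, smul_zero]
      exact horth j _ (tail_anti h (derivation_mem_tail hn D i (hmem i)))
    · simp [d]
    · rw [if_neg h.ne', smul_zero, ← hsymm, hin.symm]
      exact horth i _ (tail_anti h (derivation_mem_tail hn D j (hmem j)))
  have hdric (i) : d i = nilRicciForm Q e (e i) (e i) - β := by
    simp only [d]
    rw [hin.symm, hD, he, if_pos rfl, mul_one]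
  -- `[e_0, e_i]` satisfies the eigenvector equation for `d 0 + d i`, so it is orthogonal to `e_j`
  -- unless the eigenvalues agree.
  have hrel (i j : Fin (n + 1)) : (d 0 + d i - d j) * Q (e j) ⁅e 0, e i⁆ = 0 := by
    have h3 : D ⁅e 0, e i⁆ = (d 0 + d i) • ⁅e 0, e i⁆ := by
      rw [D.apply_lie_eq_sub, hd, hd, lie_smul, lie_smul, ← lie_skew (e 0) (e i), add_smul]
      simp only [smul_neg]
      abel
    have h4 := hsymm (e j) ⁅e 0, e i⁆
    rw [h3, hd, map_smul, map_smul, LinearMap.smul_apply, smul_eq_mul, smul_eq_mul] at h4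
    linear_combination -h4
  have hstep {k : ℕ} (hk1 : 1 ≤ k) (hk : k + 1 < n + 1) :
      d ⟨k + 1, hk⟩ = d 0 + d ⟨k, by omega⟩ := by
    have h3 := (mul_eq_zero.1 (hrel ⟨k, by omega⟩ ⟨k + 1, hk⟩)).resolve_right
      (apply_lie_succ_pos he hmem hpos horth hk1 hk).ne'
    linarith
  have hdk (k : ℕ) (hk : k + 1 < n + 1) : d ⟨k + 1, hk⟩ = d ⟨1, by omega⟩ + k * d 0 := by
    induction k with
    | zero => simp
    | succ k ih =>
      rw [hstep (by omega) hk, ih (by omega)]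
      push_cast
      ring
  have hd0 : d 0 ≠ 0 := by
    intro h0
    have h3 := hdk (n - 1) (by omega)
    have h4 : (⟨n - 1 + 1, by omega⟩ : Fin (n + 1)) = Fin.last n :=
      Fin.ext (by simp only [Fin.val_last]; omega)
    rw [h4, h0, hdric, hdric] at h3
    have h5 := nilRicciForm_one_neg hin hmem hpos horth he (by omega)
    have h6 := nilRicciForm_last_pos hin hmem hpos horth he (by omega)
    linarith
  refine ⟨Q (e ⟨i + 1, hi⟩) ⁅e 0, e ⟨i, by omega⟩⁆, hext fun j => ?_⟩
  rw [map_smul, he]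
  by_cases hj : j = ⟨i + 1, hi⟩
  · simp [hj]
  · rw [if_neg hj, smul_zero]
    obtain ⟨j, hjn⟩ := j
    cases j with
    -- `d 0` lies outside the progression and might equal `d (i + 1)`, so `e_0` is excluded by
    -- orthogonality to brackets.
    | zero => exact horth _ _ (tail_anti (by simp) (lie_mem_tail_two _ _))
    | succ j =>
      refine (mul_eq_zero.1 (hrel ⟨i, by omega⟩ ⟨j + 1, hjn⟩)).resolve_left ?_
      rw [← hstep h1 hi, hdk i hi, hdk j hjn, add_sub_add_left_eq_sub, ← sub_mul]
      refine mul_ne_zero (sub_ne_zero.2 fun h => hj ?_) hd0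
      have : i = j := by exact_mod_cast h
      exact Fin.ext (by simp only; omega)

/-- For `n ≤ 2` the flag argument fails (on the Heisenberg algebra `X₁ ↦ X₀` extends to a
derivation), but the error term lies in `tail n (i + 2) = 0`. -/
theorem exists_lie_eq_smul_of_isNilsolitonMetric (hQ : IsNilsolitonMetric Q)
    (he : IsOrthonormalBasisFor Q e) (hmem : ∀ i : Fin (n + 1), e i ∈ tail n i)
    (hpos : ∀ i, 0 < e i i)
    (horth : ∀ i : Fin (n + 1), ∀ y ∈ tail n (i + 1), Q (e i) y = 0)
    {i : ℕ} (h1 : 1 ≤ i) (hi : i + 1 < n + 1) :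
    ∃ t : ℝ, 0 < t ∧ ⁅e 0, e ⟨i, by omega⟩⁆ = t • e ⟨i + 1, hi⟩ := by
  by_cases hn : 3 ≤ n
  · obtain ⟨t, ht⟩ := lie_eq_smul_of_isNilsolitonMetric_of_three_le hQ he hmem hpos horth hn h1 hi
    refine ⟨t, ?_, ht⟩
    have := apply_lie_succ_pos he hmem hpos horth h1 hi
    simpa [ht, he _ _] using this
  · obtain ⟨t, ht, h⟩ := lie_sub_smul_mem_tail hmem hpos h1 hi
    rw [tail_eq_bot (by omega), Submodule.mem_bot, sub_eq_zero] at h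
    exact ⟨t, ht, h⟩

end Adapted

/-- Every nilsoliton metric on `L_n` is isometric to the standard metric of some `L_n(b)`. -/
theorem exists_isometry_stdMetric {Q : LinearMap.BilinForm ℝ (FiliformL n)}
    (hQ : IsNilsolitonMetric Q) : ∃ b : ℕ → ℝ, (∀ i, 1 ≤ i → i ≤ n - 1 → 0 < b i) ∧
      ∃ ψ : WeightedFiliform n b ≃ₗ⁅ℝ⁆ FiliformL n,
        ∀ x y, Q (ψ x) (ψ y) = stdMetric n b x y := by
  obtain ⟨β, hβ⟩ := id hQ
  obtain ⟨e, he, hmem, hpos, horth⟩ := exists_adapted_basis hβ.1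
  have hex (i : ℕ) : ∃ t : ℝ, ∀ (_ : 1 ≤ i) (hi : i + 1 < n + 1),
      0 < t ∧ ⁅e 0, e ⟨i, by omega⟩⁆ = t • e ⟨i + 1, hi⟩ := by
    by_cases h : 1 ≤ i ∧ i + 1 < n + 1
    · obtain ⟨t, ht⟩ := exists_lie_eq_smul_of_isNilsolitonMetric hQ he hmem hpos horth h.1 h.2
      exact ⟨t, fun _ _ => ht⟩
    · exact ⟨0, fun h1 h2 => absurd ⟨h1, h2⟩ h⟩
  choose b hb using hex
  have hone (i : Fin (n + 1)) (hi : i ≠ 0) : e i ∈ tail n 1 :=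
    tail_anti (Nat.one_le_iff_ne_zero.2 fun h => hi (Fin.ext h)) (hmem i)
  obtain ⟨ψ, hψ⟩ := exists_lieEquiv (a := b) e (fun i h1 hi => (hb i h1 hi).2)
    (by
      rcases Nat.eq_zero_or_pos n with rfl | hn
      · exact lie_self _
      · have := lie_mem_tail_succ (by rw [Fin.val_last]; exact hn) (e 0) (hmem (Fin.last n))
        rwa [tail_eq_bot (by simp), Submodule.mem_bot] at this)
    (fun i j hi hj => lie_eq_zero_of_mem_tail_one (hone i hi) (hone j hj))
  refine ⟨b, fun i h1 hi => (hb i h1 (by omega)).1, ψ, fun x y => ?_⟩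
  rw [apply_lieEquiv_eq_mul_stdMetric Q ψ (fun i j => by rw [hψ, hψ, he]), one_mul]

theorem exists_similarity_stdMetric {Q : LinearMap.BilinForm ℝ (FiliformL n)}
    (hQ : IsNilsolitonMetric Q) {ν : ℝ} (hν : 0 < ν) {a : ℕ → ℝ}
    (ha : ∀ i : ℕ, a i = √(ν / 2 * ((i : ℝ) * ((n : ℝ) - (i : ℝ))))) :
    ∃ c : ℝ, 0 < c ∧ ∃ φ : WeightedFiliform n a ≃ₗ⁅ℝ⁆ FiliformL n,
      ∀ x y, Q (φ x) (φ y) = c * stdMetric n a x y := by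
  obtain ⟨b, hb, ψ, hψ⟩ := exists_isometry_stdMetric hQ
  obtain ⟨β, hβ⟩ := hQ
  have hs (z) : ψ (ψ.symm z) = z := ψ.apply_symm_apply z
  obtain ⟨μ, hμ, hbμ⟩ := exists_sq_eq_of_isNilsolitonMetric (fun i h1 hi => (hb i h1 hi).ne')
    ⟨β, hβ.of_equiv ψ.symm fun x y => by rw [← hψ, hs, hs]⟩
  have hsab (i : ℕ) (h1 : 1 ≤ i) (hi : i ≤ n - 1) : a i = √(ν / μ) * b i := by
    rw [ha, ← Real.sqrt_sq (hb i h1 hi).le, ← Real.sqrt_mul (by positivity), hbμ i h1 hi]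
    congr 1
    field_simp
  have hs0 : 0 < √(ν / μ) := Real.sqrt_pos.2 (by positivity)
  -- A uniform scaling by `s` needs `s a_i = s² b_i`, which holds for `s = √(ν / μ)`; it multiplies
  -- the metric by `s²`.
  obtain ⟨θ, hθ⟩ := exists_diagonal_lieEquiv (n := n) (a := a) (b := b) (fun _ => √(ν / μ))
    (fun _ _ => hs0.ne') (fun i h1 hi => by
      rw [hsab i h1 (by omega)]
      ring)
  refine ⟨√(ν / μ) * √(ν / μ), by positivity, θ.trans ψ, fun x y => ?_⟩
  rw [LieEquiv.trans_apply, LieEquiv.trans_apply, hψ]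
  refine apply_lieEquiv_eq_mul_stdMetric _ θ (fun i j => ?_) x y
  rw [hθ, hθ, map_smul, map_smul, LinearMap.smul_apply, basis_orthonormal]
  split_ifs <;> simp

theorem sqrt_sq_eq {ν : ℝ} (hν : 0 < ν) {i : ℕ} (hi : i ≤ n) :
    √(ν / 2 * ((i : ℝ) * ((n : ℝ) - i))) ^ 2 = ν / 2 * ((i : ℝ) * ((n : ℝ) - i)) := by
  have : (0 : ℝ) ≤ (n : ℝ) - i := sub_nonneg.2 (by exact_mod_cast hi)
  exact Real.sq_sqrt (by positivity)

theorem sqrt_ne_zero {ν : ℝ} (hν : 0 < ν) {i : ℕ} (h1 : 1 ≤ i) (hi : i ≤ n - 1) :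
    √(ν / 2 * ((i : ℝ) * ((n : ℝ) - i))) ≠ 0 := by
  have h2 : (0 : ℝ) < (n : ℝ) - i := sub_pos.2 (by exact_mod_cast (by omega : i < n))
  have h3 : (0 : ℝ) < i := by exact_mod_cast h1
  positivity

end WeightedFiliform

open WeightedFiliform in
theorem mainTheorem7 (n : ℕ) :
    -- existence
    (∃ Q : LinearMap.BilinForm ℝ (FiliformL n), IsNilsolitonMetric Q) ∧
    -- uniqueness up to scaling (and automorphisms of the Lie algebra)
    (∀ Q Q' : LinearMap.BilinForm ℝ (FiliformL n), IsNilsolitonMetric Q → IsNilsolitonMetric Q' →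
      ∃ c : ℝ, 0 < c ∧ ∃ φ : FiliformL n ≃ₗ⁅ℝ⁆ FiliformL n,
        ∀ x y, Q' x y = c * Q (φ x) (φ y)) ∧
    -- explicit form of the nilsoliton metric
    (∀ (ν : ℝ) (a : ℕ → ℝ), 0 < ν →
      (∀ i : ℕ, a i = Real.sqrt (ν / 2 * ((i : ℝ) * ((n : ℝ) - (i : ℝ))))) →
      Nonempty (WeightedFiliform n a ≃ₗ⁅ℝ⁆ FiliformL n) ∧
      IsNilsolitonMetricWith (WeightedFiliform.stdMetric n a)
        (-(ν / 2) * (((n : ℝ) - 1) * (n : ℝ) * ((n : ℝ) + 1) / 12 + 1)) ∧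
      ∀ Q : LinearMap.BilinForm ℝ (FiliformL n), IsNilsolitonMetric Q →
        ∃ c : ℝ, 0 < c ∧ ∃ φ : WeightedFiliform n a ≃ₗ⁅ℝ⁆ FiliformL n,
          ∀ x y, Q (φ x) (φ y) = c * WeightedFiliform.stdMetric n a x y) ∧
    -- the structure constants are the solutions of a linear system of type `A_{n-1}`
    (∀ a : ℕ → ℝ, (∀ i : ℕ, 1 ≤ i → i ≤ n - 1 → a i ≠ 0) →
      Nonempty (WeightedFiliform n a ≃ₗ⁅ℝ⁆ FiliformL n) ∧
      (IsNilsolitonMetric (WeightedFiliform.stdMetric n a) ↔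
        ∃ ν : ℝ, 0 < ν ∧ Matrix.mulVec ((CartanMatrix.A (n - 1)).map (Int.cast : ℤ → ℝ))
          (fun i : Fin (n - 1) => a ((i : ℕ) + 1) ^ 2) = fun _ => ν) ∧
      (IsNilsolitonMetric (WeightedFiliform.stdMetric n a) ↔
        ∃ ν : ℝ, 0 < ν ∧ ∀ i : ℕ, 1 ≤ i → i ≤ n - 1 →
          a i ^ 2 = ν / 2 * ((i : ℝ) * ((n : ℝ) - (i : ℝ))))) := by
  have hex : IsNilsolitonMetricWith
      (stdMetric n fun i => √((2 : ℝ) / 2 * ((i : ℝ) * ((n : ℝ) - i)))) _ :=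
    isNilsolitonMetricWith_stdMetric_of_sq_eq fun i _ hi => sqrt_sq_eq two_pos (by omega)
  refine ⟨?_, fun Q Q' hQ hQ' => ?_, fun ν a hν ha => ⟨?_, ?_, fun Q hQ => ?_⟩, fun a ha =>
    ⟨nonempty_lieEquiv_filiformL ha, ?_, ?_⟩⟩
  · obtain ⟨ψ⟩ := nonempty_lieEquiv_filiformL (n := n)
      (a := fun i => √((2 : ℝ) / 2 * ((i : ℝ) * ((n : ℝ) - i))))
      fun i h1 hi => sqrt_ne_zero two_pos h1 hi
    let S : FiliformL n →ₗ[ℝ] _ := ψ.symm.toLinearEquiv.toLinearMap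
    refine ⟨(stdMetric n _).compl₁₂ S S, _, hex.of_equiv ψ fun x y => ?_⟩
    have hS (x) : S (ψ x) = x := ψ.symm_apply_apply x
    rw [LinearMap.compl₁₂_apply, hS, hS]
  -- Both metrics are compared with the explicit model at `ν = 2`.
  · obtain ⟨c, hc, φ, hφ⟩ := exists_similarity_stdMetric hQ two_pos fun _ => rfl
    obtain ⟨c', hc', φ', hφ'⟩ := exists_similarity_stdMetric hQ' two_pos fun _ => rfl
    refine ⟨c' / c, by positivity, φ'.symm.trans φ, fun x y => ?_⟩
    rw [LieEquiv.trans_apply, LieEquiv.trans_apply, hφ, ← mul_assoc, div_mul_cancel₀ _ hc.ne',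
      ← hφ']
    simp
  · exact nonempty_lieEquiv_filiformL fun i h1 hi => by
      rw [ha]
      exact sqrt_ne_zero hν h1 hi
  · refine isNilsolitonMetricWith_stdMetric_of_sq_eq fun i _ hi => ?_
    rw [ha, sqrt_sq_eq hν (by omega)]
  · exact exists_similarity_stdMetric hQ hν ha
  · simp only [cartanMatrix_mulVec_eq_iff]
    exact ⟨exists_sq_eq_of_isNilsolitonMetric ha,
      fun ⟨_, _, h⟩ => ⟨_, isNilsolitonMetricWith_stdMetric_of_sq_eq h⟩⟩
  · exact ⟨exists_sq_eq_of_isNilsolitonMetric ha,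
      fun ⟨_, _, h⟩ => ⟨_, isNilsolitonMetricWith_stdMetric_of_sq_eq h⟩⟩
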